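/- **Setting (fixed design).** Let $I\subseteq\{1,\dots,p\}$ be a set of dropped features; write $x^{(I)}$ for $x\in\mathbb R^p$ with the coordinates in $I$ replaced by given constants. Let $(\mathbf X_i,Y_i)\in\mathbb R^{p+1}$, $i=1,\dots,N$ ($N\ge 1$), be random data on a probability space for which the reduced design points $\mathbf X_i^{(I)}=x_i$ are fixed, and let $Y_i=f_{0,-I}(x_i)+w_i$. Put $\|f-g\|_N^2=\frac1N\sum_i (f(x_i)-g(x_i))^2$ and $Y=(Y_1,\dots,Y_N)^T$; for a function $f$ write $f(x)=(f(x_1),\dots,f(x_N))^T$. For a function $\mathbb K'$ of two reduced inputs, its empirical kernel matrix has entries $\frac1N\mathbb K'(x_i,x_j)$. Let $\mathcal H$ be a reproducing kernel Hilbert space of real functions of the reduced input, with (stationary) kernel $\mathbb K$, empirical kernel matrix $K=U\Lambda U^T$ ($U$ orthogonal, $\Lambda$ diagonal), and eigenvalues $\hat\lambda_1\ge\dots\ge\hat\lambda_N\ge 0$. **Model.** Starting from the full model $f_0=f_N^c$ (which may depend on the data), a gradient method such as gradient descent or gradient boosting, with step size $0<\epsilon\le\min\{1,1/\hat\lambda_1\}$,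 produces iterates $f_\tau$ with $$f_{\tau+1}(x)=(I-\epsilon K_\tau)f_\tau(x)+\epsilon K_\tau Y ,\qquad \tau=0,1,2,\dots,$$ where $K_\tau$ is the empirical kernel matrix of a (possibly random) kernel $\mathbb K_\tau$ of iteration $\tau$. Put $\eta_\tau=\tau\epsilon$, $C_{\mathcal H}=\|f_N^c-f_{0,-I}\|_{\mathcal H}$, $\widehat{\mathcal R}(\varrho)=\big[\frac1N\sum_i\min\{\hat\lambda_i,\varrho^2\}\big]^{1/2}$. Let $\hat\varrho_N$ be the smallest positive solution of $\widehat{\mathcal R}(\varrho)\le \varrho^2C_{\mathcal H}^2/(2e\sigma)$, and $$\widehat T_{\max}=\min\Big\{\tau\ge 1:\ \widehat{\mathcal R}(1/\sqrt{\eta_\tau})>\frac{C_{\mathcal H}^2}{2e\sigma\eta_\tau}\Big\}-1 .$$ Let $\delta_\tau=(K_\tau-K)(Y-f_\tau(x))$, $S=I-\epsilon\Lambda$, and $D_\tau^2=\frac{4\epsilon^2}{N}\big\|\sum_{i<\tau}S^{\tau-1-i}U^T\delta_i\big\|_2^2$. Let $g$ be a non-decreasing (possibly random) function with $D_\tau^2\le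 g(\tau)$ for all $\tau\le\widehat T_{\max}$, let $C>0$ be a constant, and let $\widehat T_{op}$ be a minimizer of $C/\eta_\tau+g(\tau)$ over $0\le\tau\le\widehat T_{\max}$, where $C/\eta_0=+\infty$. **Assumptions.** With a constant $\sigma>0$ and $O(\cdot)$-constants that do not depend on $N$, almost surely where random quantities are involved: 1. $f_{0,-I}$ and $f_N^c$, as functions of the reduced input, belong to $\mathcal H$; 2. the data $(\mathbf X_i,Y_i)$ lie in a fixed bounded set; 3. the $w_i$ are independent with mean zero and $\mathbb E e^{tw_i}\le e^{t^2\sigma^2/2}$ for all $t\in\mathbb R$; 4. $\|Y-f_N^c(x)\|_2=O(\sqrt N)$; 5. $\mathrm{tr}(K)=O(1)$; 6. $C_{\mathcal H}$ lies between two positive constants; 7. (model-specific condition: the evolving kernels are close enough to the stationary kernel) $g(\widehat T_{\max})=O(N^{-1/2})$. **Theorem.** There are universal constants $c_1,c_2>0$ such that, with probability at least $1-c_1\exp(-c_2N\hat\varrho_N^2)$, $$\|f_{\widehat T_{op}}-f_{0,-I}\|_N^2\le A\,N^{-1/2},$$ where the constant $A$ depends only on $\sigma$, $C$ and the constants in Assumptions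 2 and 4–7 (not on $N$, $p$, $I$, $\epsilon$, the design, the kernels or the noise distribution). If $f_N^c$, and hence $\hat\varrho_N$, is random, the probability bound holds with almost every value of $\hat\varrho_N$. -/

import Mathlib

open MeasureTheory ProbabilityTheory
open scoped ENNReal NNReal

universe u v

set_option pp.deepTerms true

noncomputable section

/-- Inputs in `ℝ^p` whose features in `I` have been replaced by the constants `m j`
(the possible values of `X^{(I)}`). -/
def DroppedInput {p : ℕ} (I : Finset (Fin p)) (m : Fin p → ℝ) : Type :=
  {x : EuclideanSpace ℝ (Fin p) // ∀ j ∈ I, x j = m j}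

/-- Dropping the features in `I`: coordinate `j ∈ I` is replaced by the constant `m j`. -/
def dropFeatures {p : ℕ} (I : Finset (Fin p)) (m : Fin p → ℝ)
    (x : EuclideanSpace ℝ (Fin p)) : DroppedInput I m :=
  ⟨WithLp.toLp 2 (fun j => if j ∈ I then m j else x j), fun j hj => by simp [hj]⟩

section General

variable {𝒳 : Type*} {N : ℕ}

/-- The squared empirical norm `‖f - g‖_N² = (1/N) ∑ (f(x_i) - g(x_i))²`. -/
def empiricalDistSq (x : Fin N → 𝒳) (f g : 𝒳 → ℝ) : ℝ :=
  (1 / (N : ℝ)) * ∑ i, (f (x i) - g (x i)) ^ 2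

/-- The empirical kernel matrix, with entries `𝕂(x_i, x_j) / N`. -/
def empiricalKernelMatrix (k : 𝒳 → 𝒳 → ℝ) (x : Fin N → 𝒳) : Matrix (Fin N) (Fin N) ℝ :=
  Matrix.of fun i j => (1 / (N : ℝ)) * k (x i) (x j)

section Kernel

variable (H : Type*) [NormedAddCommGroup H] [InnerProductSpace ℝ H] [CompleteSpace H]
  [RKHS ℝ H 𝒳 ℝ]

/-- The real-valued reproducing kernel of a real RKHS of functions on `𝒳`. -/
def reproducingKernel (x y : 𝒳) : ℝ := RKHS.kernel H x y 1

theorem reproducingKernel_symm (x y : 𝒳) :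
    reproducingKernel H x y = reproducingKernel H y x := by
  have h : inner ℝ (RKHS.kernel H x y (1 : ℝ)) (1 : ℝ) =
      inner ℝ (RKHS.kernel H y x (1 : ℝ)) (1 : ℝ) :=
    (RKHS.kernel_inner H x y 1 1).trans
      ((real_inner_comm _ _).trans (RKHS.kernel_inner H y x 1 1).symm)
  rw [RCLike.inner_apply, RCLike.inner_apply] at h
  simpa [reproducingKernel] using h

/-- The empirical kernel matrix of the kernel of an RKHS is symmetric. -/
theorem isHermitian_empiricalKernelMatrix (x : Fin N → 𝒳) :
    (empiricalKernelMatrix (reproducingKernel H) x).IsHermitian := by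
  ext i j
  simp [empiricalKernelMatrix, reproducingKernel_symm H (x j) (x i)]

/-- The empirical kernel matrix `K` of the kernel of an RKHS. -/
def stationaryMatrix (x : Fin N → 𝒳) : Matrix (Fin N) (Fin N) ℝ :=
  empiricalKernelMatrix (reproducingKernel H) x

/-- The eigenvalues `λ̂_i` of the empirical kernel matrix `K`. -/
def stationaryEigenvalues (x : Fin N → 𝒳) : Fin N → ℝ :=
  (isHermitian_empiricalKernelMatrix H x).eigenvalues

/-- An orthogonal matrix `U` of eigenvectors: `K = U Λ Uᵀ`. -/
def stationaryEigenvectors (x : Fin N → 𝒳) : Matrix (Fin N) (Fin N) ℝ :=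
  (isHermitian_empiricalKernelMatrix H x).eigenvectorUnitary

end Kernel

/-- The local empirical Rademacher complexity `[(1/N) ∑ min(lam_i, ϱ²)]^{1/2}` of a kernel matrix
with eigenvalues `lam`. -/
def localRademacher (lam : Fin N → ℝ) (ϱ : ℝ) : ℝ :=
  √((1 / (N : ℝ)) * ∑ i, min (lam i) (ϱ ^ 2))

/-- `ϱ` is the critical empirical radius: the smallest positive solution of
`R̂(ϱ) ≤ ϱ² CH² / (2 e σ)`. -/
def IsCriticalRadius (lam : Fin N → ℝ) (σ CH ϱ : ℝ) : Prop :=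
  IsLeast {r : ℝ | 0 < r ∧ localRademacher lam r ≤ r ^ 2 * CH ^ 2 / (2 * Real.exp 1 * σ)} ϱ

/-- `T = min {τ | R̂(1/√η_τ) > CH² / (2 e σ η_τ)} - 1`, where `η_τ = τ ε`.
(At `τ = 0` the right-hand side is `+∞`, so that `τ = 0` is never in the set.) -/
def IsMaxStoppingTime (lam : Fin N → ℝ) (σ CH ε : ℝ) (T : ℕ) : Prop :=
  IsLeast {τ : ℕ | 0 < τ ∧
    CH ^ 2 / (2 * Real.exp 1 * σ * (τ * ε)) < localRademacher lam (1 / √(τ * ε))} (T + 1)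

/-- The objective `C / η_τ + g(τ)` with `η_τ = τ ε`, in `[0, ∞]`: it is `∞` at `τ = 0`. -/
def stoppingObjective (C ε : ℝ) (g : ℕ → ℝ) (τ : ℕ) : ℝ≥0∞ :=
  ENNReal.ofReal C / ENNReal.ofReal (τ * ε) + ENNReal.ofReal (g τ)

/-- `T` minimizes `C / η_τ + g(τ)` over `τ ≤ Tmax`. -/
def IsOptimalStoppingTime (C ε : ℝ) (g : ℕ → ℝ) (Tmax T : ℕ) : Prop :=
  T ≤ Tmax ∧ ∀ τ ≤ Tmax, stoppingObjective C ε g T ≤ stoppingObjective C ε g τ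

/-- The iterative kernel update equation at the design points `x`:
`f_{τ+1}(x) = (I - ε K_τ) f_τ(x) + ε K_τ Y`, with `K_τ` the empirical kernel matrix of the kernel
`k τ` of iteration `τ`. -/
def KernelUpdate (ε : ℝ) (x : Fin N → 𝒳) (k : ℕ → 𝒳 → 𝒳 → ℝ) (y : Fin N → ℝ)
    (f : ℕ → 𝒳 → ℝ) : Prop :=
  ∀ τ : ℕ, (fun i => f (τ + 1) (x i)) =
    (1 - ε • empiricalKernelMatrix (k τ) x).mulVec (fun i => f τ (x i)) +
      ε • (empiricalKernelMatrix (k τ) x).mulVec y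

/-- The shrinkage matrix `S^τ = (I - ε Λ)^τ`, with `Λ` the diagonal matrix of eigenvalues. -/
def shrinkage (ε : ℝ) (lam : Fin N → ℝ) (τ : ℕ) : Matrix (Fin N) (Fin N) ℝ :=
  (1 - ε • Matrix.diagonal lam) ^ τ

section Difference

variable (H : Type*) [NormedAddCommGroup H] [InnerProductSpace ℝ H] [CompleteSpace H]
  [RKHS ℝ H 𝒳 ℝ]

/-- `δ_τ = (K_τ - K) (Y - f_τ(x))`. -/
def kernelDrift (x : Fin N → 𝒳) (k : ℕ → 𝒳 → 𝒳 → ℝ) (y : Fin N → ℝ) (f : ℕ → 𝒳 → ℝ)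
    (τ : ℕ) : Fin N → ℝ :=
  (empiricalKernelMatrix (k τ) x - stationaryMatrix H x).mulVec (fun i => y i - f τ (x i))

/-- The difference term
`D_τ² = (4 ε² / N) ‖∑_{i < τ} S^{τ-1-i} Uᵀ δ_i‖₂²`, where `K = U Λ Uᵀ`. -/
def differenceTerm (ε : ℝ) (x : Fin N → 𝒳) (k : ℕ → 𝒳 → 𝒳 → ℝ) (y : Fin N → ℝ)
    (f : ℕ → 𝒳 → ℝ) (τ : ℕ) : ℝ :=
  4 * ε ^ 2 / N * ∑ j, ((∑ i ∈ Finset.range τ,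
    (shrinkage ε (stationaryEigenvalues H x) (τ - 1 - i)).mulVec
      ((stationaryEigenvectors H x).transpose.mulVec (kernelDrift H x k y f i))) j) ^ 2

end Difference

end General

end

/-! ### Exponential moments of quadratic forms in sub-Gaussian noise -/

section Chaos

/-! In the eigenbasis of `K`, with `s_j = 1 - ε λ_j` and `η = τε`, the error at time `τ` is a bias
`s_j ^ τ` times the initial error, plus `1 - s_j ^ τ` times the noise, plus the accumulated kernel
drift (`error_coeff_eq`). The drift is bounded by `g`, hence is `O(N^{-1/2})`.

Bias: since `λ s ^ (2τ) ≤ 1/η`, `sum_filtered_coeff_sq_le` bounds it by `C_H²/η`. As `tr K = O(1)`,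
the Rademacher complexity is `O(N^{-1/2})`, so both `1/η` at the maximal time and the squared
critical radius are at most a constant times `N^{-1/2}`. Comparing the minimizer of `C/η + g` with
the maximal time carries the bound on `1/η` over to the optimal time.

Noise: the stopping times are random and may depend on the noise, but the weights `(1 - s_j ^ τ)²`
increase with `τ`. It therefore suffices to control one quadratic form, at the largest value `T` of
the maximal time, which is deterministic. Its weights are at most `1` and sum to `O(√N)`, so
`measureReal_quadratic_gt_le` gives failure probability at most `exp (-N κ N^{-1/2}) ≤ exp (-N ϱ²)`.
-/

theorem lintegral_exp_mul_gaussianReal (a : ℝ) :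
    ∫⁻ x, ENNReal.ofReal (Real.exp (a * x)) ∂(gaussianReal 0 1) =
      ENNReal.ofReal (Real.exp (a ^ 2 / 2)) := by
  rw [← ofReal_integral_eq_lintegral_ofReal (integrable_exp_mul_gaussianReal a)
    (ae_of_all _ fun x => (Real.exp_pos _).le)]
  have h := congrFun (mgf_fun_id_gaussianReal (μ := 0) (v := 1)) a
  rw [mgf] at h
  simp [h]

/-- After squaring, `(1 + 2y)(1 - y) = 1 + y(1 - 2y) ≥ 1` and `1 + 2y ≤ exp (2y)` suffice. -/
theorem sqrt_one_div_one_sub_le_exp {y : ℝ} (hy0 : 0 ≤ y) (hy : y ≤ 1 / 2) :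
    √(1 / (1 - y)) ≤ Real.exp y := by
  rw [Real.sqrt_le_left (Real.exp_pos _).le, ← Real.exp_nat_mul]
  have h1 : (2 * y + 1) ≤ Real.exp (2 * y) := Real.add_one_le_exp _
  refine le_trans ?_ h1
  rw [div_le_iff₀ (by linarith)]
  nlinarith

theorem lintegral_exp_sq_gaussianReal_le {y : ℝ} (hy0 : 0 ≤ y) (hy : y ≤ 1 / 2) :
    ∫⁻ x, ENNReal.ofReal (Real.exp (y / 2 * x ^ 2)) ∂(gaussianReal 0 1) ≤
      ENNReal.ofReal (Real.exp y) := by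
  rw [gaussianReal_of_var_ne_zero _ one_ne_zero,
    lintegral_withDensity_eq_lintegral_mul _ (measurable_gaussianPDF 0 1) (by fun_prop)]
  have hb : 0 < (1 - y) / 2 := by linarith
  have hπ := Real.pi_pos
  have key : ∀ x : ℝ, (gaussianPDF 0 1 * fun x => ENNReal.ofReal (Real.exp (y / 2 * x ^ 2))) x =
      ENNReal.ofReal ((√(2 * Real.pi))⁻¹ * Real.exp (-((1 - y) / 2) * x ^ 2)) := by
    intro x
    rw [Pi.mul_apply, gaussianPDF, ← ENNReal.ofReal_mul (gaussianPDFReal_nonneg _ _ _),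
      gaussianPDFReal, mul_assoc, ← Real.exp_add]
    congr 2
    · simp
    · congr 1
      simp
      ring
  rw [lintegral_congr key, ← ofReal_integral_eq_lintegral_ofReal
    ((integrable_exp_neg_mul_sq hb).const_mul _) (ae_of_all _ fun x => by positivity),
    integral_const_mul, integral_gaussian]
  refine ENNReal.ofReal_le_ofReal (le_trans (le_of_eq ?_) (sqrt_one_div_one_sub_le_exp hy0 hy))
  rw [← Real.sqrt_inv, ← Real.sqrt_mul (by positivity)]
  congr 1
  have : 1 - y ≠ 0 := by linarith
  field_simp

variable {ι Ω : Type*} [Fintype ι] [MeasurableSpace Ω] {P : Measure Ω}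

theorem lintegral_exp_sum_mul_le [IsProbabilityMeasure P] {w : ι → Ω → ℝ} {σ : ℝ}
    (hw : iIndepFun w P) (hsub : ∀ i, HasSubgaussianMGF (w i) (Real.toNNReal (σ ^ 2)) P)
    (a : ι → ℝ) :
    ∫⁻ ω, ENNReal.ofReal (Real.exp (∑ i, a i * w i ω)) ∂P ≤
      ENNReal.ofReal (Real.exp (σ ^ 2 / 2 * ∑ i, a i ^ 2)) := by
  have hind : iIndepFun (fun i ω => a i * w i ω) P :=
    hw.comp (fun i z => a i * z) (fun i => by fun_prop)
  have h := HasSubgaussianMGF.sum_of_iIndepFun (s := Finset.univ) hind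
    (c := fun i => Real.toNNReal (a i ^ 2) * Real.toNNReal (σ ^ 2))
    (fun i _ => by
      rw [Real.toNNReal_of_nonneg (sq_nonneg (a i))]
      exact (hsub i).const_mul (a i))
  have hint := h.integrable_exp_mul 1
  have hle := h.mgf_le 1
  simp only [one_mul] at hint
  rw [← ofReal_integral_eq_lintegral_ofReal hint (ae_of_all _ fun x => (Real.exp_pos _).le)]
  refine ENNReal.ofReal_le_ofReal ?_
  simp only [mgf, one_mul] at hle
  refine hle.trans (Real.exp_le_exp.2 (le_of_eq ?_))
  simp only [NNReal.coe_sum, NNReal.coe_mul, Real.coe_toNNReal _ (sq_nonneg _)]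
  rw [← Finset.sum_mul]
  ring

theorem lintegral_prod_pi_le (μ : Measure ℝ) [IsProbabilityMeasure μ] (F : ι → ℝ → ℝ≥0∞)
    (hF : ∀ i, Measurable (F i)) :
    ∫⁻ x, ∏ i, F i (x i) ∂(Measure.pi fun _ : ι => μ) = ∏ i, ∫⁻ x, F i x ∂μ := by
  have hind : iIndepFun (fun i (x : ι → ℝ) => F i (x i)) (Measure.pi fun _ : ι => μ) :=
    iIndepFun_pi (fun i => (hF i).aemeasurable)
  have h := lintegral_prod_eq_prod_lintegral_of_indepFun Finset.univ
    (fun i (x : ι → ℝ) => F i (x i)) hind (fun i => (hF i).comp (measurable_pi_apply i))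
  rw [h]
  refine Finset.prod_congr rfl fun i _ => ?_
  exact (measurePreserving_eval (fun _ : ι => μ) i).lintegral_comp (hF i)

variable [DecidableEq ι]

theorem sum_sq_mulVec_of_orthogonal {U : Matrix ι ι ℝ} (hU : U.transpose * U = 1) (v : ι → ℝ) :
    ∑ i, (U.mulVec v i) ^ 2 = ∑ i, v i ^ 2 := by
  have h : U.mulVec v ⬝ᵥ U.mulVec v = v ⬝ᵥ v := by
    rw [Matrix.dotProduct_mulVec, ← Matrix.mulVec_transpose, Matrix.mulVec_mulVec, hU,
      Matrix.one_mulVec]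
  simpa [dotProduct, sq] using h

/-- Gaussian linearization: `exp (a²/2)` is the mean of `exp (a z)` for standard normal `z`.
Introducing independent `z_j` makes the exponent linear in the noise. After Tonelli, the
sub-Gaussian bound applies for fixed `z`, orthogonality of `U` makes the remaining quadratic form in
`z` diagonal, and the Gaussian integral factorizes. -/
theorem lintegral_exp_quadratic_le [IsProbabilityMeasure P] {w : ι → Ω → ℝ} {σ : ℝ}
    (hm : ∀ i, Measurable (w i))
    (hw : iIndepFun w P) (hsub : ∀ i, HasSubgaussianMGF (w i) (Real.toNNReal (σ ^ 2)) P)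
    {U : Matrix ι ι ℝ} (hU : U.transpose * U = 1) (b : ι → ℝ)
    (hb : ∀ j, σ ^ 2 * b j ^ 2 ≤ 1 / 2) :
    ∫⁻ ω, ENNReal.ofReal (Real.exp (∑ j, (b j * (U.transpose.mulVec fun i => w i ω) j) ^ 2 / 2)) ∂P
      ≤ ENNReal.ofReal (Real.exp (σ ^ 2 * ∑ j, b j ^ 2)) := by
  set γ : Measure (ι → ℝ) := Measure.pi fun _ : ι => gaussianReal 0 1 with hγ
  have hn : ∀ j, Measurable fun ω => (U.transpose.mulVec fun i => w i ω) j := by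
    intro j
    simp only [Matrix.mulVec, dotProduct]
    fun_prop
  have hswap : ∀ (z : ι → ℝ) (ω : Ω), ∑ j, b j * (U.transpose.mulVec fun i => w i ω) j * z j =
      ∑ i, (U.mulVec fun j => b j * z j) i * w i ω := by
    intro z ω
    have h := Matrix.dotProduct_mulVec (fun j => b j * z j) U.transpose (fun i => w i ω)
    rw [Matrix.vecMul_transpose] at h
    simp only [dotProduct] at h
    rw [← h]
    exact Finset.sum_congr rfl fun j _ => by ring
  calc ∫⁻ ω, ENNReal.ofReal
        (Real.exp (∑ j, (b j * (U.transpose.mulVec fun i => w i ω) j) ^ 2 / 2)) ∂P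
      = ∫⁻ ω, ∫⁻ z, ENNReal.ofReal
          (Real.exp (∑ j, b j * (U.transpose.mulVec fun i => w i ω) j * z j)) ∂γ ∂P := by
        refine lintegral_congr fun ω => ?_
        have h := lintegral_prod_pi_le (gaussianReal 0 1)
          (fun j z => ENNReal.ofReal
            (Real.exp (b j * (U.transpose.mulVec fun i => w i ω) j * z))) (fun j => by fun_prop)
        simp only [lintegral_exp_mul_gaussianReal] at h
        simp_rw [Real.exp_sum, ENNReal.ofReal_prod_of_nonneg (fun i _ => (Real.exp_pos _).le)]
        exact h.symm
    _ = ∫⁻ z, ∫⁻ ω, ENNReal.ofReal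
          (Real.exp (∑ j, b j * (U.transpose.mulVec fun i => w i ω) j * z j)) ∂P ∂γ := by
        refine lintegral_lintegral_swap (Measurable.aemeasurable ?_)
        refine ENNReal.measurable_ofReal.comp (Real.measurable_exp.comp ?_)
        refine Finset.measurable_sum _ fun j _ => ?_
        exact (((hn j).comp measurable_fst).const_mul (b j)).mul
          ((measurable_pi_apply j).comp measurable_snd)
    _ ≤ ∫⁻ z, ENNReal.ofReal (Real.exp (∑ j, σ ^ 2 * b j ^ 2 / 2 * z j ^ 2)) ∂γ := by
        refine lintegral_mono fun z => ?_
        simp only [hswap]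
        refine (lintegral_exp_sum_mul_le hw hsub _).trans (ENNReal.ofReal_le_ofReal ?_)
        rw [sum_sq_mulVec_of_orthogonal hU, Finset.mul_sum]
        refine Real.exp_le_exp.2 (le_of_eq (Finset.sum_congr rfl fun j _ => by ring))
    _ ≤ ENNReal.ofReal (Real.exp (σ ^ 2 * ∑ j, b j ^ 2)) := by
        rw [Finset.mul_sum]
        simp_rw [Real.exp_sum, ENNReal.ofReal_prod_of_nonneg (fun i _ => (Real.exp_pos _).le)]
        rw [hγ, lintegral_prod_pi_le (gaussianReal 0 1)
          (fun j z => ENNReal.ofReal (Real.exp (σ ^ 2 * b j ^ 2 / 2 * z ^ 2)))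
          (fun j => by fun_prop)]
        exact Finset.prod_le_prod' fun j _ =>
          lintegral_exp_sq_gaussianReal_le (by positivity) (hb j)

/-- Upper tail of a weighted sum of squares of an orthogonal image of sub-Gaussian noise. -/
theorem measureReal_quadratic_gt_le [IsProbabilityMeasure P] {w : ι → Ω → ℝ} {σ : ℝ} (hσ : 0 < σ)
    (hm : ∀ i, Measurable (w i))
    (hw : iIndepFun w P) (hsub : ∀ i, HasSubgaussianMGF (w i) (Real.toNNReal (σ ^ 2)) P)
    {U : Matrix ι ι ℝ} (hU : U.transpose * U = 1) (c : ι → ℝ)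
    (hc0 : ∀ j, 0 ≤ c j) (hc1 : ∀ j, c j ≤ 1) (s : ℝ) :
    P.real {ω | s < ∑ j, c j * (U.transpose.mulVec fun i => w i ω) j ^ 2} ≤
      Real.exp (-s / (4 * σ ^ 2) + (∑ j, c j) / 2) := by
  have hb2 : ∀ j, √(c j / (2 * σ ^ 2)) ^ 2 = c j / (2 * σ ^ 2) := fun j =>
    Real.sq_sqrt (div_nonneg (hc0 j) (by positivity))
  -- Scaling chosen so that `σ² b_j² = c_j / 2`, which `c_j ≤ 1` keeps within the admissible range
  -- `≤ 1/2`; Markov's inequality for the exponential then gives the tail.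
  have h := lintegral_exp_quadratic_le hm hw hsub hU (fun j => √(c j / (2 * σ ^ 2))) (by
    intro j
    rw [hb2]
    have := hc1 j
    rw [mul_div_assoc', div_le_iff₀ (by positivity)]
    nlinarith [sq_nonneg σ])
  have hquad : ∀ ω, ∑ j, (√(c j / (2 * σ ^ 2)) * (U.transpose.mulVec fun i => w i ω) j) ^ 2 / 2 =
      (∑ j, c j * (U.transpose.mulVec fun i => w i ω) j ^ 2) / (4 * σ ^ 2) := by
    intro ω
    rw [Finset.sum_div]
    refine Finset.sum_congr rfl fun j _ => ?_
    rw [mul_pow, hb2]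
    field_simp
    ring
  have hsum : σ ^ 2 * ∑ j, √(c j / (2 * σ ^ 2)) ^ 2 = (∑ j, c j) / 2 := by
    simp_rw [hb2]
    rw [← Finset.sum_div]
    field_simp
  rw [hsum] at h
  simp_rw [hquad] at h
  have hmeas : Measurable fun ω => ENNReal.ofReal (Real.exp
      ((∑ j, c j * (U.transpose.mulVec fun i => w i ω) j ^ 2) / (4 * σ ^ 2))) := by
    simp only [Matrix.mulVec, dotProduct]
    fun_prop
  have hmk := mul_meas_ge_le_lintegral (μ := P) hmeas
    (ENNReal.ofReal (Real.exp (s / (4 * σ ^ 2))))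
  have hsubset : {ω | s < ∑ j, c j * (U.transpose.mulVec fun i => w i ω) j ^ 2} ⊆
      {ω | ENNReal.ofReal (Real.exp (s / (4 * σ ^ 2))) ≤ ENNReal.ofReal (Real.exp
      ((∑ j, c j * (U.transpose.mulVec fun i => w i ω) j ^ 2) / (4 * σ ^ 2)))} := by
    intro ω hω
    simp only [Set.mem_ofPred_eq] at hω ⊢
    gcongr
  have hfin := (mul_le_mul_right (measure_mono hsubset) _).trans (hmk.trans h)
  have hreal := ENNReal.toReal_mono ENNReal.ofReal_ne_top hfin
  rw [ENNReal.toReal_mul, ENNReal.toReal_ofReal (Real.exp_pos _).le,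
    ENNReal.toReal_ofReal (Real.exp_pos _).le] at hreal
  have heq : Real.exp (-s / (4 * σ ^ 2) + (∑ j, c j) / 2) =
      Real.exp ((∑ j, c j) / 2) / Real.exp (s / (4 * σ ^ 2)) := by
    rw [← Real.exp_sub]
    ring_nf
  rw [heq, le_div_iff₀ (Real.exp_pos _), mul_comm]
  exact hreal

end Chaos

/-! ### Spectral analysis of the iteration and deterministic bounds on radii and stopping times -/

section Deterministic

variable {𝒳 : Type*} {N : ℕ}

section Spectral

variable (H : Type*) [NormedAddCommGroup H] [InnerProductSpace ℝ H] [CompleteSpace H]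
  [RKHS ℝ H 𝒳 ℝ]

theorem stationaryEigenvectors_transpose_mul (x : Fin N → 𝒳) :
    (stationaryEigenvectors H x).transpose * stationaryEigenvectors H x = 1 := by
  have h := Unitary.coe_star_mul_self (isHermitian_empiricalKernelMatrix H x).eigenvectorUnitary
  rwa [Matrix.star_eq_conjTranspose, Matrix.conjTranspose_eq_transpose_of_trivial] at h

theorem stationaryEigenvectors_mul_transpose (x : Fin N → 𝒳) :
    stationaryEigenvectors H x * (stationaryEigenvectors H x).transpose = 1 :=
  mul_eq_one_comm.1 (stationaryEigenvectors_transpose_mul H x)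

theorem stationaryMatrix_eq (x : Fin N → 𝒳) :
    stationaryMatrix H x = stationaryEigenvectors H x *
      Matrix.diagonal (stationaryEigenvalues H x) * (stationaryEigenvectors H x).transpose := by
  have h := (isHermitian_empiricalKernelMatrix H x).spectral_theorem
  rw [Unitary.conjStarAlgAut_apply, Matrix.star_eq_conjTranspose,
    Matrix.conjTranspose_eq_transpose_of_trivial] at h
  exact h

theorem transpose_mulVec_stationaryMatrix (x : Fin N → 𝒳) (v : Fin N → ℝ) (j : Fin N) :
    ((stationaryEigenvectors H x).transpose.mulVec ((stationaryMatrix H x).mulVec v)) j =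
      stationaryEigenvalues H x j * ((stationaryEigenvectors H x).transpose.mulVec v) j := by
  rw [Matrix.mulVec_mulVec, stationaryMatrix_eq, ← Matrix.mul_assoc, ← Matrix.mul_assoc,
    stationaryEigenvectors_transpose_mul, Matrix.one_mul, ← Matrix.mulVec_mulVec,
    Matrix.mulVec_diagonal]

theorem sum_sq_transpose_mulVec (x : Fin N → 𝒳) (v : Fin N → ℝ) :
    ∑ j, ((stationaryEigenvectors H x).transpose.mulVec v) j ^ 2 = ∑ i, v i ^ 2 :=
  sum_sq_mulVec_of_orthogonal
    (by rw [Matrix.transpose_transpose, stationaryEigenvectors_mul_transpose]) v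

theorem inner_kerFun_one (x y : 𝒳) :
    inner ℝ (RKHS.kerFun H x (1 : ℝ)) (RKHS.kerFun H y (1 : ℝ)) = reproducingKernel H x y := by
  rw [← RKHS.kernel_inner, RCLike.inner_apply, reproducingKernel_symm H x y]
  simp [reproducingKernel]

theorem norm_sq_sum_kerFun (hN : 0 < N) (x : Fin N → 𝒳) (a : Fin N → ℝ) :
    ‖∑ i, a i • RKHS.kerFun H (x i) (1 : ℝ)‖ ^ 2 = N * ∑ j, stationaryEigenvalues H x j *
      ((stationaryEigenvectors H x).transpose.mulVec a) j ^ 2 := by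
  have hN' : (N : ℝ) ≠ 0 := by positivity
  have h1 : ‖∑ i, a i • RKHS.kerFun H (x i) (1 : ℝ)‖ ^ 2 =
      N * (a ⬝ᵥ (stationaryMatrix H x).mulVec a) := by
    rw [← real_inner_self_eq_norm_sq, sum_inner]
    simp only [dotProduct, Matrix.mulVec, Finset.mul_sum, inner_sum, stationaryMatrix,
      empiricalKernelMatrix, Matrix.of_apply, real_inner_smul_left, real_inner_smul_right,
      inner_kerFun_one]
    refine Finset.sum_congr rfl fun i _ => Finset.sum_congr rfl fun j _ => ?_
    field_simp
  have h2 : a ⬝ᵥ (stationaryMatrix H x).mulVec a =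
      ((stationaryEigenvectors H x).transpose.mulVec a) ⬝ᵥ
        ((stationaryEigenvectors H x).transpose.mulVec ((stationaryMatrix H x).mulVec a)) := by
    rw [eq_comm, Matrix.dotProduct_mulVec, Matrix.vecMul_transpose, Matrix.mulVec_mulVec,
      stationaryEigenvectors_mul_transpose, Matrix.one_mulVec]
  rw [h1, h2]
  simp only [dotProduct, transpose_mulVec_stationaryMatrix]
  congr 1
  exact Finset.sum_congr rfl fun j _ => by ring

/-- Taking an eigenvector as coefficient vector exhibits `N λ_j` as a squared norm in `H`. -/
theorem stationaryEigenvalues_nonneg (hN : 0 < N) (x : Fin N → 𝒳) (j : Fin N) :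
    0 ≤ stationaryEigenvalues H x j := by
  have h := norm_sq_sum_kerFun H hN x ((stationaryEigenvectors H x).mulVec (Pi.single j 1))
  rw [Matrix.mulVec_mulVec, stationaryEigenvectors_transpose_mul, Matrix.one_mulVec] at h
  simp only [Pi.single_apply, ite_pow, one_pow, zero_pow two_ne_zero, mul_ite, mul_one, mul_zero,
    Finset.sum_ite_eq', Finset.mem_univ, if_true] at h
  have hN' : (0 : ℝ) < N := by positivity
  exact nonneg_of_mul_nonneg_right (h ▸ sq_nonneg _) hN'

theorem sum_stationaryEigenvalues (x : Fin N → 𝒳) :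
    ∑ j, stationaryEigenvalues H x j = (stationaryMatrix H x).trace := by
  rw [stationaryMatrix_eq, Matrix.trace_mul_comm, ← Matrix.mul_assoc,
    stationaryEigenvectors_transpose_mul, Matrix.one_mul, Matrix.trace_diagonal]

theorem stationaryEigenvalues_le_trace (hN : 0 < N) (x : Fin N → 𝒳) (j : Fin N) :
    stationaryEigenvalues H x j ≤ (stationaryMatrix H x).trace := by
  rw [← sum_stationaryEigenvalues]
  exact Finset.single_le_sum (fun i _ => stationaryEigenvalues_nonneg H hN x i) (Finset.mem_univ j)

variable {H} in
/-- The spectral coefficients of the values of an element of the RKHS decay at the rate of the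
eigenvalues of the empirical kernel matrix. -/
theorem sum_filtered_coeff_sq_le (hN : 0 < N) (x : Fin N → 𝒳) (h : H) {μ : Fin N → ℝ} {B : ℝ}
    (hB : 0 ≤ B) (hμ0 : ∀ j, 0 ≤ μ j) (hμ : ∀ j, stationaryEigenvalues H x j * μ j ≤ B) :
    ∑ j, μ j * ((stationaryEigenvectors H x).transpose.mulVec fun i => h (x i)) j ^ 2 ≤
      N * B * ‖h‖ ^ 2 := by
  set v := (stationaryEigenvectors H x).transpose.mulVec fun i => h (x i) with hv
  set a := (stationaryEigenvectors H x).mulVec fun j => μ j * v j with ha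
  have hUa : (stationaryEigenvectors H x).transpose.mulVec a = fun j => μ j * v j := by
    rw [ha, Matrix.mulVec_mulVec, stationaryEigenvectors_transpose_mul, Matrix.one_mulVec]
  -- The reproducing property turns the filtered sum into a pairing of `h` with a kernel
  -- combination. By Cauchy–Schwarz, the square of the sum is then at most `N B ‖h‖²` times the sum
  -- itself, which is cancelled at the end; `K` need not be invertible.
  have hq : ∑ j, μ j * v j ^ 2 =
      inner ℝ (∑ i, a i • RKHS.kerFun H (x i) (1 : ℝ)) h := by
    have h1 : inner ℝ (∑ i, a i • RKHS.kerFun H (x i) (1 : ℝ)) h =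
        a ⬝ᵥ (fun i => h (x i)) := by
      simp [sum_inner, real_inner_smul_left, dotProduct]
    rw [h1, ha, dotProduct_comm, Matrix.dotProduct_mulVec, ← Matrix.mulVec_transpose, ← hv]
    simp only [dotProduct]
    exact Finset.sum_congr rfl fun j _ => by ring
  have hcs := abs_real_inner_le_norm (∑ i, a i • RKHS.kerFun H (x i) (1 : ℝ)) h
  rw [← hq] at hcs
  have hsq := pow_le_pow_left₀ (abs_nonneg _) hcs 2
  rw [sq_abs, mul_pow, norm_sq_sum_kerFun H hN, hUa] at hsq
  have hbound : ∑ j, stationaryEigenvalues H x j * (μ j * v j) ^ 2 ≤ B * ∑ j, μ j * v j ^ 2 := by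
    rw [Finset.mul_sum]
    refine Finset.sum_le_sum fun j _ => ?_
    have := mul_le_mul_of_nonneg_right (hμ j) (mul_nonneg (hμ0 j) (sq_nonneg (v j)))
    nlinarith
  have hq0 : 0 ≤ ∑ j, μ j * v j ^ 2 := Finset.sum_nonneg fun j _ => mul_nonneg (hμ0 j) (sq_nonneg _)
  set q := ∑ j, μ j * v j ^ 2
  have hfin : q ^ 2 ≤ (N * B * ‖h‖ ^ 2) * q := by
    have := mul_le_mul_of_nonneg_left hbound (by positivity : (0 : ℝ) ≤ N * ‖h‖ ^ 2)
    nlinarith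
  rcases hq0.eq_or_lt with h0 | h0
  · rw [← h0]; positivity
  · rw [sq] at hfin
    exact le_of_mul_le_mul_right hfin h0

end Spectral

theorem shrinkage_mulVec (ε : ℝ) (lam : Fin N → ℝ) (n : ℕ) (v : Fin N → ℝ) (j : Fin N) :
    (shrinkage ε lam n).mulVec v j = (1 - ε * lam j) ^ n * v j := by
  have h : shrinkage ε lam n = Matrix.diagonal (fun j => (1 - ε * lam j) ^ n) := by
    rw [shrinkage, ← Matrix.diagonal_one, ← Matrix.diagonal_smul, Matrix.diagonal_sub,
      Matrix.diagonal_pow]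
    rfl
  rw [h, Matrix.mulVec_diagonal]

/-! ### Error decomposition along the iteration -/

section Iteration

variable (H : Type*) [NormedAddCommGroup H] [InnerProductSpace ℝ H] [CompleteSpace H]
  [RKHS ℝ H 𝒳 ℝ]

/-- Spectral decomposition of the error of the iterates into bias, noise and kernel drift. -/
theorem error_coeff_eq {ε : ℝ} {x : Fin N → 𝒳} {k : ℕ → 𝒳 → 𝒳 → ℝ} {y w f₀ : Fin N → ℝ}
    {f : ℕ → 𝒳 → ℝ} (hy : ∀ i, y i = f₀ i + w i) (hf : KernelUpdate ε x k y f)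
    (τ : ℕ) (j : Fin N) :
    ((stationaryEigenvectors H x).transpose.mulVec fun i => f τ (x i) - f₀ i) j =
      (1 - ε * stationaryEigenvalues H x j) ^ τ *
        ((stationaryEigenvectors H x).transpose.mulVec fun i => f 0 (x i) - f₀ i) j +
      (1 - (1 - ε * stationaryEigenvalues H x j) ^ τ) *
        ((stationaryEigenvectors H x).transpose.mulVec w) j +
      ε * (∑ i ∈ Finset.range τ,
        (shrinkage ε (stationaryEigenvalues H x) (τ - 1 - i)).mulVec
          ((stationaryEigenvectors H x).transpose.mulVec (kernelDrift H x k y f i))) j := by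
  induction τ with
  | zero => simp
  | succ τ ih =>
    -- Writing `K_τ = K + (K_τ - K)` turns the update into the stationary recursion with forcing `ε
    -- δ_τ`.
    have hstep : (fun i => f (τ + 1) (x i) - f₀ i) = (fun i => f τ (x i) - f₀ i) -
        ε • (stationaryMatrix H x).mulVec (fun i => f τ (x i) - f₀ i) +
        ε • (stationaryMatrix H x).mulVec w + ε • kernelDrift H x k y f τ := by
      have h0 : (fun i => f (τ + 1) (x i) - f₀ i) = (fun i => f (τ + 1) (x i)) - f₀ := rfl
      have h1 : (fun i => f τ (x i) - f₀ i) = (fun i => f τ (x i)) - f₀ := rfl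
      have h2 : kernelDrift H x k y f τ =
        (empiricalKernelMatrix (k τ) x - stationaryMatrix H x).mulVec
          (f₀ + w - fun i => f τ (x i)) := by
        rw [kernelDrift]
        congr 1
        ext i
        simp [hy i]
      have h3 : y = f₀ + w := funext hy
      rw [h0, h1, h2, hf τ, h3]
      simp only [Matrix.sub_mulVec, Matrix.one_mulVec, Matrix.smul_mulVec, Matrix.mulVec_add,
        Matrix.mulVec_sub, smul_sub, smul_add]
      abel
    rw [hstep, Matrix.mulVec_add, Matrix.mulVec_add, Matrix.mulVec_sub, Matrix.mulVec_smul,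
      Matrix.mulVec_smul, Matrix.mulVec_smul]
    simp only [Pi.add_apply, Pi.sub_apply, Pi.smul_apply, smul_eq_mul,
      transpose_mulVec_stationaryMatrix]
    rw [ih]
    simp only [Finset.sum_apply, shrinkage_mulVec]
    rw [Finset.sum_range_succ]
    have hsum : ∑ i ∈ Finset.range τ, (1 - ε * stationaryEigenvalues H x j) ^ (τ + 1 - 1 - i) *
          ((stationaryEigenvectors H x).transpose.mulVec (kernelDrift H x k y f i)) j =
        (1 - ε * stationaryEigenvalues H x j) * ∑ i ∈ Finset.range τ,
          (1 - ε * stationaryEigenvalues H x j) ^ (τ - 1 - i) *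
          ((stationaryEigenvectors H x).transpose.mulVec (kernelDrift H x k y f i)) j := by
      rw [Finset.mul_sum]
      refine Finset.sum_congr rfl fun i hi => ?_
      have hi' := Finset.mem_range.1 hi
      rw [← mul_assoc, ← pow_succ', show τ + 1 - 1 - i = τ - 1 - i + 1 by omega]
    rw [hsum]
    simp only [add_tsub_cancel_right, tsub_self, pow_zero, one_mul]
    ring

theorem empiricalDistSq_iterate_le {ε : ℝ} {x : Fin N → 𝒳} {k : ℕ → 𝒳 → 𝒳 → ℝ}
    {y w : Fin N → ℝ} {f₀ : 𝒳 → ℝ} {f : ℕ → 𝒳 → ℝ} (hN : 0 < N)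
    (hy : ∀ i, y i = f₀ (x i) + w i)
    (hf : KernelUpdate ε x k y f) (τ : ℕ) :
    empiricalDistSq x (f τ) f₀ ≤
      3 / N * (∑ j, ((1 - ε * stationaryEigenvalues H x j) ^ τ) ^ 2 *
        ((stationaryEigenvectors H x).transpose.mulVec fun i => f 0 (x i) - f₀ (x i)) j ^ 2) +
      3 / N * (∑ j, (1 - (1 - ε * stationaryEigenvalues H x j) ^ τ) ^ 2 *
        ((stationaryEigenvectors H x).transpose.mulVec w) j ^ 2) +
      differenceTerm H ε x k y f τ := by
  have hN' : (0 : ℝ) < N := by positivity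
  rw [empiricalDistSq, ← sum_sq_transpose_mulVec H x (fun i => f τ (x i) - f₀ (x i)),
    differenceTerm, Finset.mul_sum, Finset.mul_sum, Finset.mul_sum, Finset.mul_sum,
    ← Finset.sum_add_distrib, ← Finset.sum_add_distrib]
  refine Finset.sum_le_sum fun j _ => ?_
  rw [error_coeff_eq H (f₀ := fun i => f₀ (x i)) hy hf τ j]
  set a := (1 - ε * stationaryEigenvalues H x j) ^ τ *
    ((stationaryEigenvectors H x).transpose.mulVec fun i => f 0 (x i) - f₀ (x i)) j with ha
  set b := (1 - (1 - ε * stationaryEigenvalues H x j) ^ τ) *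
        ((stationaryEigenvectors H x).transpose.mulVec w) j with hb
  set d := (∑ i ∈ Finset.range τ, (shrinkage ε (stationaryEigenvalues H x) (τ - 1 - i)).mulVec
      ((stationaryEigenvectors H x).transpose.mulVec (kernelDrift H x k y f i))) j
  rw [← mul_pow, ← mul_pow, ← ha, ← hb]
  -- The weight `4`, rather than `3`, matches the factor `4 ε² / N` in `differenceTerm`.
  have key : (a + b + ε * d) ^ 2 ≤ 3 * a ^ 2 + 3 * b ^ 2 + 4 * (ε * d) ^ 2 := by
    nlinarith [sq_nonneg (a - b), sq_nonneg (a - ε * d), sq_nonneg (b - ε * d),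
      sq_nonneg (ε * d)]
  calc 1 / (N : ℝ) * (a + b + ε * d) ^ 2
      ≤ 1 / (N : ℝ) * (3 * a ^ 2 + 3 * b ^ 2 + 4 * (ε * d) ^ 2) := by gcongr
    _ = _ := by ring

end Iteration

/-! ### Filter inequalities, critical radius and stopping times -/

section Scalar

theorem mul_one_sub_pow_le {u : ℝ} (hu0 : 0 ≤ u) (hu1 : u ≤ 1) (n : ℕ) :
    n * (u * (1 - u) ^ n) ≤ 1 := by
  have h1 : (1 - u) ^ n ≤ Real.exp (-(n * u)) := by
    calc (1 - u) ^ n ≤ Real.exp (-u) ^ n :=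
          pow_le_pow_left₀ (by linarith) (Real.one_sub_le_exp_neg u) n
      _ = Real.exp (-(n * u)) := by rw [← Real.exp_nat_mul]; ring_nf
  have h2 : n * u ≤ Real.exp (n * u) := by linarith [Real.add_one_le_exp ((n : ℝ) * u)]
  have h3 : (n * u) * Real.exp (-(n * u)) ≤ 1 := by
    rw [Real.exp_neg, ← div_eq_mul_inv]
    exact (div_le_one (Real.exp_pos _)).2 h2
  calc n * (u * (1 - u) ^ n) = (n * u) * (1 - u) ^ n := by ring
    _ ≤ (n * u) * Real.exp (-(n * u)) := by gcongr
    _ ≤ 1 := h3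

/-- Decay of the bias filter `lam (1 - ε lam)^{2τ}`. -/
theorem mul_shrinkage_sq_le {lam ε : ℝ} (hε : 0 < ε) (h0 : 0 ≤ lam) (h1 : ε * lam ≤ 1) {τ : ℕ}
    (hτ : 0 < τ) : lam * ((1 - ε * lam) ^ τ) ^ 2 ≤ 1 / (τ * ε) := by
  have hs0 : 0 ≤ 1 - ε * lam := by linarith
  have hs1 : (1 - ε * lam) ^ τ ≤ 1 := pow_le_one₀ hs0 (by nlinarith)
  have hsn : 0 ≤ (1 - ε * lam) ^ τ := pow_nonneg hs0 τ
  have h := mul_one_sub_pow_le (by positivity) h1 τ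
  have hτ' : (0 : ℝ) < τ := by positivity
  rw [le_div_iff₀ (by positivity)]
  calc lam * ((1 - ε * lam) ^ τ) ^ 2 * (τ * ε)
      ≤ lam * ((1 - ε * lam) ^ τ) * (τ * ε) := by
        gcongr
        nlinarith
    _ ≤ 1 := by linarith

theorem one_sub_shrinkage_nonneg {lam ε : ℝ} (hε : 0 < ε) (h0 : 0 ≤ lam) (h1 : ε * lam ≤ 1)
    (τ : ℕ) : 0 ≤ 1 - (1 - ε * lam) ^ τ :=
  sub_nonneg.2 (pow_le_one₀ (by linarith) (by nlinarith))

theorem one_sub_shrinkage_sq_mono {lam ε : ℝ} (hε : 0 < ε) (h0 : 0 ≤ lam) (h1 : ε * lam ≤ 1)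
    {τ T : ℕ} (hτ : τ ≤ T) : (1 - (1 - ε * lam) ^ τ) ^ 2 ≤ (1 - (1 - ε * lam) ^ T) ^ 2 :=
  pow_le_pow_left₀ (one_sub_shrinkage_nonneg hε h0 h1 τ)
    (sub_le_sub_left (pow_le_pow_of_le_one (by linarith) (by nlinarith) hτ) 1) 2

theorem one_sub_shrinkage_sq_le_one {lam ε : ℝ} (hε : 0 < ε) (h0 : 0 ≤ lam) (h1 : ε * lam ≤ 1)
    (τ : ℕ) : (1 - (1 - ε * lam) ^ τ) ^ 2 ≤ 1 :=
  pow_le_one₀ (one_sub_shrinkage_nonneg hε h0 h1 τ)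
    (sub_le_self _ (pow_nonneg (by linarith) _))

/-- A number in `[0, 1]` dominates its square, and Bernoulli gives `1 - (1 - ε λ)^τ ≤ η λ`; together
these produce `min (η λ) 1`, the summand of the Rademacher complexity scaled by `η`. -/
theorem one_sub_shrinkage_sq_le {lam ε : ℝ} (hε : 0 < ε) (h0 : 0 ≤ lam) (h1 : ε * lam ≤ 1)
    {τ : ℕ} (hτ : 0 < τ) :
    (1 - (1 - ε * lam) ^ τ) ^ 2 ≤ τ * ε * min lam ((1 / √(τ * ε)) ^ 2) := by
  have hτ' : (0 : ℝ) < τ := by positivity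
  have hη : 0 < τ * ε := by positivity
  have hc0 := one_sub_shrinkage_nonneg hε h0 h1 τ
  have hc1 : 1 - (1 - ε * lam) ^ τ ≤ 1 := sub_le_self _ (pow_nonneg (by linarith) _)
  have hb : 1 - (1 - ε * lam) ^ τ ≤ τ * ε * lam := by
    have := one_add_mul_le_pow (a := -(ε * lam)) (by linarith) τ
    rw [← sub_eq_add_neg] at this
    linarith
  rw [div_pow, one_pow, Real.sq_sqrt hη.le, mul_min_of_nonneg _ _ hη.le, mul_one_div_cancel hη.ne']
  have hsq : (1 - (1 - ε * lam) ^ τ) ^ 2 ≤ 1 - (1 - ε * lam) ^ τ := by nlinarith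
  exact le_min (hsq.trans hb) (hsq.trans hc1)

theorem localRademacher_le {lam : Fin N → ℝ} {c : ℝ} (h : ∑ i, lam i ≤ c) (r : ℝ) :
    localRademacher lam r ≤ √c * (√N)⁻¹ := by
  rw [localRademacher, ← Real.sqrt_inv, ← Real.sqrt_mul' _ (by positivity)]
  refine Real.sqrt_le_sqrt ?_
  rw [one_div, mul_comm]
  gcongr
  exact (Finset.sum_le_sum fun i _ => min_le_left _ _).trans h

theorem localRademacher_sq {lam : Fin N → ℝ} (h : ∀ i, 0 ≤ lam i) (r : ℝ) :
    localRademacher lam r ^ 2 = (1 / (N : ℝ)) * ∑ i, min (lam i) (r ^ 2) :=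
  Real.sq_sqrt (mul_nonneg (by positivity)
    (Finset.sum_nonneg fun i _ => le_min (h i) (sq_nonneg r)))

theorem IsCriticalRadius.sq_le {lam : Fin N → ℝ} {σ CH ϱ c : ℝ} (hN : 0 < N) (hσ : 0 < σ)
    (hCH : 0 < CH) (hc : 0 < c) (h : ∑ i, lam i ≤ c) (hϱ : IsCriticalRadius lam σ CH ϱ) :
    ϱ ^ 2 ≤ 2 * Real.exp 1 * σ * √c / CH ^ 2 * (√N)⁻¹ := by
  have he := Real.exp_pos 1
  have hN' : (0 : ℝ) < N := by positivity
  set s := 2 * Real.exp 1 * σ * √c / CH ^ 2 * (√N)⁻¹ with hs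
  have hs0 : 0 < s := by positivity
  have hle : ϱ ≤ √s := by
    refine hϱ.2 ⟨Real.sqrt_pos.2 hs0, (localRademacher_le h _).trans (le_of_eq ?_)⟩
    rw [Real.sq_sqrt hs0.le, hs]
    field_simp
  calc ϱ ^ 2 ≤ √s ^ 2 := pow_le_pow_left₀ hϱ.1.1.le hle 2
    _ = s := Real.sq_sqrt hs0.le

/-- The defining strict inequality at `T + 1` bounds `1/η` by the complexity, which the trace
controls. This form also covers `T = 0`. -/
theorem IsMaxStoppingTime.one_div_succ_le {lam : Fin N → ℝ} {σ CH ε c : ℝ} {T : ℕ}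
    (hσ : 0 < σ) (hCH : 0 < CH) (hε : 0 < ε) (h : ∑ i, lam i ≤ c)
    (hT : IsMaxStoppingTime lam σ CH ε T) :
    1 / ((T + 1) * ε) ≤ 2 * Real.exp 1 * σ * √c / CH ^ 2 * (√N)⁻¹ := by
  have he := Real.exp_pos 1
  have h1 := hT.1.2.le.trans (localRademacher_le h _)
  push_cast at h1
  have hT' : (0 : ℝ) < T + 1 := by positivity
  calc 1 / ((T + 1) * ε)
      = CH ^ 2 / (2 * Real.exp 1 * σ * ((T + 1) * ε)) * (2 * Real.exp 1 * σ / CH ^ 2) := by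
        field_simp
    _ ≤ √c * (√N)⁻¹ * (2 * Real.exp 1 * σ / CH ^ 2) := by gcongr
    _ = _ := by ring

theorem IsMaxStoppingTime.localRademacher_le {lam : Fin N → ℝ} {σ CH ε : ℝ} {T : ℕ}
    (hT : IsMaxStoppingTime lam σ CH ε T) (hT0 : 0 < T) :
    localRademacher lam (1 / √(T * ε)) ≤ CH ^ 2 / (2 * Real.exp 1 * σ * (T * ε)) := by
  by_contra hcon
  have := hT.2 ⟨hT0, not_le.1 hcon⟩
  omega

theorem IsMaxStoppingTime.exists_pos {lam : Fin N → ℝ} {σ CH ε : ℝ} {T : ℕ}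
    (hσ : 0 < σ) (hCH : 0 < CH) (hε : 0 < ε) (hT : IsMaxStoppingTime lam σ CH ε T) :
    ∃ i, 0 < lam i := by
  by_contra! hcon
  have he := Real.exp_pos 1
  have h0 : localRademacher lam (1 / √((T + 1 : ℕ) * ε)) = 0 := by
    rw [localRademacher, Real.sqrt_eq_zero_of_nonpos]
    exact mul_nonpos_of_nonneg_of_nonpos (by positivity)
      (Finset.sum_nonpos fun i _ => (min_le_left _ _).trans (hcon i))
  have h1 := hT.1.2
  rw [h0] at h1
  exact absurd h1 (not_lt.2 (by positivity))

/-- Maximum stopping times are bounded uniformly over the radius of the RKHS ball. -/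
theorem exists_bound_maxStoppingTime {lam : Fin N → ℝ} {σ ε M : ℝ} (hN : 0 < N) (hσ : 0 < σ)
    (hε : 0 < ε) (h0 : ∀ i, 0 ≤ lam i) (hpos : ∃ i, 0 < lam i) :
    ∃ b : ℕ, ∀ CH T, 0 ≤ CH → CH ≤ M → IsMaxStoppingTime lam σ CH ε T → T ≤ b := by
  obtain ⟨i, hi⟩ := hpos
  have he := Real.exp_pos 1
  have hN' : (0 : ℝ) < N := by positivity
  set D := N * (M ^ 2 / (2 * Real.exp 1 * σ)) ^ 2 with hD
  have hD0 : 0 ≤ D := by positivity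
  obtain ⟨b, hb⟩ := exists_nat_ge ((1 / lam i + D) / ε)
  refine ⟨b, fun CH T hCH0 hCH hT => ?_⟩
  rcases Nat.eq_zero_or_pos T with rfl | hT0
  · exact Nat.zero_le b
  have hT' : (0 : ℝ) < T := by positivity
  have hη : 0 < T * ε := by positivity
  have hle := hT.localRademacher_le hT0
  have hle2 : localRademacher lam (1 / √(T * ε)) ≤ M ^ 2 / (2 * Real.exp 1 * σ) / (T * ε) := by
    rw [div_div]
    exact hle.trans (by gcongr)
  have hsq : localRademacher lam (1 / √(T * ε)) ^ 2 ≤ _ :=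
    pow_le_pow_left₀ (Real.sqrt_nonneg _) hle2 2
  rw [localRademacher_sq h0, div_pow, one_pow, Real.sq_sqrt hη.le] at hsq
  have hsingle : min (lam i) (1 / (T * ε)) ≤ ∑ i, min (lam i) (1 / (T * ε)) :=
    Finset.single_le_sum (f := fun i => min (lam i) (1 / (T * ε)))
      (fun j _ => le_min (h0 j) (by positivity)) (Finset.mem_univ i)
  have hmin : min (lam i) (1 / (T * ε)) ≤ D / (T * ε) ^ 2 := by
    have h1 := mul_le_mul_of_nonneg_left hsq hN'.le
    rw [← mul_assoc, mul_one_div_cancel hN'.ne', one_mul] at h1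
    refine hsingle.trans (h1.trans (le_of_eq ?_))
    rw [hD]
    field_simp
  -- Once `1/η ≤ λ_i`, the minimum is `1/η`, and `1/η ≤ D/η²` forces `η ≤ D`.
  have hfin : T * ε ≤ 1 / lam i + D := by
    by_cases hc : T * ε ≤ 1 / lam i
    · linarith
    · have hc' : 1 / (T * ε) ≤ lam i := by
        rw [one_div_le hη hi]
        exact (not_le.1 hc).le
      rw [min_eq_right hc', div_le_div_iff₀ hη (by positivity), sq, one_mul] at hmin
      have := le_of_mul_le_mul_right hmin hη
      have : 0 < 1 / lam i := by positivity
      linarith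
  have : (T : ℝ) ≤ b := le_trans ((le_div_iff₀ hε).2 hfin) hb
  exact_mod_cast this

theorem IsOptimalStoppingTime.pos {C ε : ℝ} {g : ℕ → ℝ} {Tmax T : ℕ} (hC : 0 < C) (hε : 0 < ε)
    (h : IsOptimalStoppingTime C ε g Tmax T) (hT : 0 < Tmax) : 0 < T := by
  rcases Nat.eq_zero_or_pos T with rfl | h0
  · have h1 := h.2 Tmax le_rfl
    have hTε : 0 < Tmax * ε := by positivity
    have hC' : ENNReal.ofReal C ≠ 0 := by simpa using hC
    simp only [stoppingObjective, CharP.cast_eq_zero, zero_mul, ENNReal.ofReal_zero,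
      ENNReal.div_zero hC', top_add, top_le_iff, ENNReal.add_eq_top, ENNReal.ofReal_ne_top,
      or_false] at h1
    rw [← ENNReal.ofReal_div_of_pos hTε] at h1
    exact absurd h1 ENNReal.ofReal_ne_top
  · exact h0

/-- Comparison of the minimizer with `Tmax`. The truncation at `0` reflects `ENNReal.ofReal` in the
objective. -/
theorem IsOptimalStoppingTime.div_le {C ε : ℝ} {g : ℕ → ℝ} {Tmax T : ℕ} (hC : 0 < C) (hε : 0 < ε)
    (h : IsOptimalStoppingTime C ε g Tmax T) (hT : 0 < Tmax) :
    C / (T * ε) ≤ C / (Tmax * ε) + max (g Tmax) 0 := by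
  have hT0 := h.pos hC hε hT
  have h1 := h.2 Tmax le_rfl
  have hη : 0 < Tmax * ε := by positivity
  have hη' : 0 < T * ε := by positivity
  simp only [stoppingObjective] at h1
  rw [← ENNReal.ofReal_div_of_pos hη, ← ENNReal.ofReal_div_of_pos hη'] at h1
  have h2 := (le_self_add.trans h1).trans
    (add_le_add_right (ENNReal.ofReal_le_ofReal (le_max_left (g Tmax) 0)) _)
  rw [← ENNReal.ofReal_add (by positivity) (le_max_right _ _),
    ENNReal.ofReal_le_ofReal_iff (by positivity)] at h2
  exact h2

end Scalar

end Deterministic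

/-! ### Noise level at the maximal time, and the main theorem -/

/-- The sum is at most `N η R̂(1/√η)²`, and the stopping rule bounds `R̂` by a multiple of `1/η`,
leaving a single factor `1/η`. -/
theorem sum_one_sub_shrinkage_sq_le {N : ℕ} {lam : Fin N → ℝ} {σ CH ε : ℝ} {T : ℕ} (hN : 0 < N)
    (hε : 0 < ε) (h0 : ∀ i, 0 ≤ lam i) (h1 : ∀ i, ε * lam i ≤ 1)
    (hT : IsMaxStoppingTime lam σ CH ε T) (hT0 : 0 < T) :
    ∑ j, (1 - (1 - ε * lam j) ^ T) ^ 2 ≤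
      N * (CH ^ 2 / (2 * Real.exp 1 * σ)) ^ 2 * (1 / (T * ε)) := by
  have hN' : (0 : ℝ) < N := by positivity
  have hη : 0 < T * ε := by positivity
  have hsq : localRademacher lam (1 / √(T * ε)) ^ 2 ≤ _ :=
    pow_le_pow_left₀ (Real.sqrt_nonneg _) (hT.localRademacher_le hT0) 2
  calc ∑ j, (1 - (1 - ε * lam j) ^ T) ^ 2
      ≤ ∑ j, T * ε * min (lam j) ((1 / √(T * ε)) ^ 2) :=
        Finset.sum_le_sum fun j _ => one_sub_shrinkage_sq_le hε (h0 j) (h1 j) hT0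
    _ = N * (T * ε) * localRademacher lam (1 / √(T * ε)) ^ 2 := by
        rw [localRademacher_sq h0, ← Finset.mul_sum]
        field_simp
    _ ≤ N * (T * ε) * (CH ^ 2 / (2 * Real.exp 1 * σ * (T * ε))) ^ 2 := by gcongr
    _ = _ := by
        rw [← div_div (CH ^ 2)]
        field_simp

theorem IsMaxStoppingTime.one_div_le {N : ℕ} {lam : Fin N → ℝ} {σ CH ε c : ℝ} {T : ℕ}
    (hσ : 0 < σ) (hCH : 0 < CH) (hε : 0 < ε) (h : ∑ i, lam i ≤ c)
    (hT : IsMaxStoppingTime lam σ CH ε T) (hT0 : 0 < T) :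
    1 / (T * ε) ≤ 2 * (2 * Real.exp 1 * σ * √c / CH ^ 2 * (√N)⁻¹) := by
  have hT' : (1 : ℝ) ≤ T := by exact_mod_cast hT0
  have h1 := hT.one_div_succ_le hσ hCH hε h
  -- Passing from `T + 1` to `T ≥ 1` costs the factor `2`, since `T + 1 ≤ 2T`.
  have h2 : 1 / (T * ε) ≤ 2 * (1 / ((T + 1) * ε)) := by
    rw [mul_one_div, div_le_div_iff₀ (by positivity) (by positivity)]
    nlinarith
  linarith

theorem theorem1 :
    -- the universal constants in the probability
    ∃ c₁ c₂ : ℝ, 0 < c₁ ∧ 0 < c₂ ∧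
    -- problem constants, on which the constant `A` of the rate may depend
    ∀ σ C R CHmin CHmax Cdrop Ctr Cdiff : ℝ, 0 < σ → 0 < C → 0 < CHmin →
    ∃ A : ℝ, 0 < A ∧
    -- sample size, dimension, dropped features, step size and design points
    ∀ (N p : ℕ) (I : Finset (Fin p)) (m : Fin p → ℝ) (ε : ℝ) (x : Fin N → DroppedInput I m)
      -- the RKHS of the stationary kernel
      (H : Type v) [NormedAddCommGroup H] [InnerProductSpace ℝ H] [CompleteSpace H]
      [RKHS ℝ H (DroppedInput I m) ℝ]
      -- the probability space, the data and the noise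
      (Ω : Type u) [MeasurableSpace Ω] (P : Measure Ω) [IsProbabilityMeasure P]
      (X : Fin N → Ω → EuclideanSpace ℝ (Fin p)) (Y w : Fin N → Ω → ℝ)
      -- the reduced regression function, the full model, and their representatives in `H`
      (f₀ : DroppedInput I m → ℝ) (fc : Ω → EuclideanSpace ℝ (Fin p) → ℝ) (h₀ : H) (hc : Ω → H)
      -- the iterates and the evolving kernels
      (f : Ω → ℕ → EuclideanSpace ℝ (Fin p) → ℝ)
      (k : Ω → ℕ → DroppedInput I m → DroppedInput I m → ℝ)
      -- the bound on the difference term, the critical radius and the stopping times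
      (g : Ω → ℕ → ℝ) (ϱ : Ω → ℝ) (Tmax Top : Ω → ℕ),
    0 < N →
    -- step size: `0 < ε ≤ min {1, 1 / λ̂₁}`
    0 < ε → ε ≤ 1 → (∀ i, ε * stationaryEigenvalues H x i ≤ 1) →
    -- fixed design, and the observations
    (∀ᵐ ω ∂P, ∀ i, dropFeatures I m (X i ω) = x i) →
    (∀ᵐ ω ∂P, ∀ i, Y i ω = f₀ (x i) + w i ω) →
    -- the target and the full model lie in the RKHS
    (∀ z, f₀ z = h₀ z) →
    (∀ᵐ ω ∂P, ∀ z : DroppedInput I m, fc ω z.1 = hc ω z) →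
    (∀ᵐ ω ∂P, CHmin ≤ ‖hc ω - h₀‖ ∧ ‖hc ω - h₀‖ ≤ CHmax) →
    -- the data are bounded
    (∀ᵐ ω ∂P, ∀ i, ‖X i ω‖ ≤ R ∧ |Y i ω| ≤ R) →
    -- the noise variables are independent, zero-mean and sub-Gaussian
    (∀ i, Measurable (w i)) → iIndepFun w P → (∀ i, ∫ ω, w i ω ∂P = 0) →
    (∀ i, HasSubgaussianMGF (w i) (Real.toNNReal (σ ^ 2)) P) →
    -- the dropout error is `O(√N)`
    (∀ᵐ ω ∂P, √(∑ i, (Y i ω - fc ω (x i).1) ^ 2) ≤ Cdrop * √N) →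
    -- the trace of the kernel matrix is `O(1)`
    (stationaryMatrix H x).trace ≤ Ctr →
    -- warm start at the full model, and the iterative kernel update equation
    (∀ᵐ ω ∂P, f ω 0 = fc ω ∧
      KernelUpdate ε x (k ω) (fun i => Y i ω) (fun τ z => f ω τ z.1)) →
    -- critical radius and stopping times
    (∀ᵐ ω ∂P, IsCriticalRadius (stationaryEigenvalues H x) σ ‖hc ω - h₀‖ (ϱ ω)) →
    (∀ᵐ ω ∂P, IsMaxStoppingTime (stationaryEigenvalues H x) σ ‖hc ω - h₀‖ ε (Tmax ω)) →
    (∀ᵐ ω ∂P, IsOptimalStoppingTime C ε (g ω) (Tmax ω) (Top ω)) →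
    -- model-specific condition: the evolving kernel is so close to the stationary one that
    -- the difference term is at most a non-decreasing function `g` which is `O(N^{-1/2})`
    (∀ᵐ ω ∂P, Monotone (g ω) ∧
      (∀ τ ≤ Tmax ω, differenceTerm H ε x (k ω) (fun i => Y i ω)
        (fun τ z => f ω τ z.1) τ ≤ g ω τ) ∧
      g ω (Tmax ω) ≤ Cdiff * (N : ℝ) ^ (-(1 / 2) : ℝ)) →
    -- conclusion
    ∃ G : Set Ω, MeasurableSet G ∧
      (∀ ω ∈ G, empiricalDistSq x (fun z => f ω (Top ω) z.1) f₀ ≤ A * (N : ℝ) ^ (-(1 / 2) : ℝ)) ∧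
      ∀ᵐ ω₀ ∂P, 1 - c₁ * Real.exp (-c₂ * N * ϱ ω₀ ^ 2) ≤ P.real G := by
  refine ⟨1, 1, one_pos, one_pos, fun σ C R CHmin CHmax Cdrop Ctr Cdiff hσ hC hmin => ?_⟩
  have he := Real.exp_pos 1
  set c := max Ctr 1 with hc_def
  have hc : 0 < c := lt_max_of_lt_right one_pos
  set κ := 2 * Real.exp 1 * σ * √c / CHmin ^ 2 with hκ_def
  have hκ : 0 < κ := by positivity
  set B := (CHmax ^ 2 / (2 * Real.exp 1 * σ)) ^ 2 * (2 * κ) with hB_def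
  have hB : 0 ≤ B := by positivity
  -- Noise threshold: in the tail exponent, `B / 2` cancels half the sum of the weights and `κ`
  -- remains to dominate the critical radius.
  set t := 4 * σ ^ 2 * (κ + B / 2) with ht_def
  have ht : 0 < t := by positivity
  set d := max Cdiff 0 with hd_def
  have hd : 0 ≤ d := le_max_right _ _
  -- The summands pay for bias, noise, drift and the degenerate case `Tmax ω = 0`.
  refine ⟨3 * ((2 * κ + d / C) * CHmax ^ 2) + 3 * t + d + c * CHmax ^ 2 * κ, by positivity, ?_⟩
  intro N p I m ε x H _ _ _ _ Ω _ P _ X Y w f₀ fc h₀ hc' f k g ϱ Tmax Top hN hε hε1 hεlam _ hY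
    hf₀ hfc hCH _ hwm hwi _ hsub _ htr hupd hϱ hTmax hTop hg
  set lam := stationaryEigenvalues H x with hlam_def
  have hlam0 : ∀ j, 0 ≤ lam j := stationaryEigenvalues_nonneg H hN x
  have hsum : ∑ j, lam j ≤ c := by
    rw [hlam_def, sum_stationaryEigenvalues]
    exact htr.trans (le_max_left _ _)
  have hN' : (0 : ℝ) < N := by positivity
  set n := (√(N : ℝ))⁻¹ with hn_def
  have hn : 0 < n := by positivity
  have hnpow : (N : ℝ) ^ (-(1 / 2) : ℝ) = n := by
    rw [Real.rpow_neg hN'.le, ← Real.sqrt_eq_rpow]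
  rw [hnpow] at hg ⊢
  have hκ_le : ∀ CH, CHmin ≤ CH → 2 * Real.exp 1 * σ * √c / CH ^ 2 * n ≤ κ * n := by
    intro CH hCH
    rw [hκ_def]
    gcongr
  obtain ⟨G₀, hG₀, hG₀m, hgood⟩ := Filter.Eventually.exists_measurable_mem
    (hY.and (hfc.and (hCH.and (hupd.and (hTmax.and (hTop.and hg))))))
  have hne : G₀.Nonempty := by
    by_contra hcon
    rw [Set.not_nonempty_iff_eq_empty.1 hcon] at hG₀
    simp at hG₀
  -- the largest value of the maximum stopping time
  obtain ⟨T, ⟨ω₁, hω₁, hTω₁⟩, hTle⟩ : ∃ T, (∃ ω ∈ G₀, Tmax ω = T) ∧ ∀ ω ∈ G₀, Tmax ω ≤ T := by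
    obtain ⟨ω, hω⟩ := hne
    obtain ⟨-, -, hCω, -, hTω, -⟩ := hgood ω hω
    obtain ⟨b, hb⟩ := exists_bound_maxStoppingTime (M := CHmax) hN hσ hε hlam0
      (hTω.exists_pos hσ (hmin.trans_le hCω.1) hε)
    have hbdd : BddAbove (Tmax '' G₀) := by
      refine ⟨b, ?_⟩
      rintro _ ⟨ω', hω', rfl⟩
      obtain ⟨-, -, hCω', -, hTω', -⟩ := hgood ω' hω'
      exact hb _ _ (norm_nonneg _) hCω'.2 hTω'
    obtain ⟨ω', hω', h⟩ := Nat.sSup_mem (Set.Nonempty.image Tmax ⟨ω, hω⟩) hbdd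
    exact ⟨_, ⟨ω', hω', h⟩, fun ω'' hω'' => le_csSup hbdd (Set.mem_image_of_mem _ hω'')⟩
  -- The value `T` is attained at `ω₁`, so the stopping rule with the norm `‖hc' ω₁ - h₀‖` applies
  -- to it although that norm is random.
  have hvar : ∑ j, (1 - (1 - ε * lam j) ^ T) ^ 2 ≤ N * (B * n) := by
    rcases Nat.eq_zero_or_pos T with h0 | h0
    · rw [h0]
      simp only [pow_zero, sub_self, zero_pow two_ne_zero, Finset.sum_const_zero]
      positivity
    · obtain ⟨-, -, hCω, -, hTω, -⟩ := hgood ω₁ hω₁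
      rw [hTω₁] at hTω
      have hpos := hmin.trans_le hCω.1
      have h1 := hTω.one_div_le hσ hpos hε hsum h0
      have h2 := hκ_le _ hCω.1
      calc _ ≤ _ := sum_one_sub_shrinkage_sq_le hN hε hlam0 hεlam hTω h0
        _ ≤ N * (CHmax ^ 2 / (2 * Real.exp 1 * σ)) ^ 2 * (2 * (κ * n)) := by
          have h3 := hCω.2
          gcongr
          linarith
        _ = N * (B * n) := by rw [hB_def]; ring
  set V : Ω → ℝ := fun ω => ∑ j, (1 - (1 - ε * lam j) ^ T) ^ 2 *
    ((stationaryEigenvectors H x).transpose.mulVec fun i => w i ω) j ^ 2 with hV_def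
  have hVm : Measurable V := by
    simp only [hV_def, Matrix.mulVec, dotProduct]
    fun_prop
  have htail : P.real {ω | N * (t * n) < V ω} ≤ Real.exp (-(N * (κ * n))) := by
    refine (measureReal_quadratic_gt_le hσ hwm hwi hsub
      (stationaryEigenvectors_transpose_mul H x) _ (fun j => sq_nonneg _)
      (fun j => one_sub_shrinkage_sq_le_one hε (hlam0 j) (hεlam j) T) (N * (t * n))).trans
      (Real.exp_le_exp.2 ?_)
    have h1 : -(N * (t * n)) / (4 * σ ^ 2) = -(N * (κ * n)) - N * (B * n) / 2 := by
      rw [ht_def]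
      field_simp
      ring
    linarith
  have hEm : MeasurableSet {ω | N * (t * n) < V ω} := measurableSet_lt measurable_const hVm
  refine ⟨G₀ ∩ {ω | N * (t * n) < V ω}ᶜ, hG₀m.inter hEm.compl, ?_, ?_⟩
  · rintro ω ⟨hω, hVω⟩
    have hVω' : V ω ≤ N * (t * n) := not_lt.1 hVω
    obtain ⟨hYω, hfcω, hCω, ⟨hf0, hup⟩, hTω, hopt, hmono, hdiff, hgT⟩ := hgood ω hω
    have hpos := hmin.trans_le hCω.1
    have hM : ‖hc' ω - h₀‖ ^ 2 ≤ CHmax ^ 2 := pow_le_pow_left₀ (norm_nonneg _) hCω.2 2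
    have hinit : (fun i => f ω 0 (x i).1 - f₀ (x i)) = fun i => (hc' ω - h₀) (x i) := by
      ext i
      rw [hf0, hfcω, hf₀, RKHS.coe_sub, Pi.sub_apply]
    rcases Nat.eq_zero_or_pos (Tmax ω) with hT0 | hT0
    · have hTop0 : Top ω = 0 := Nat.le_zero.1 (hT0 ▸ hopt.1)
      have h1 := (hTω.one_div_succ_le hσ hpos hε hsum).trans (hκ_le _ hCω.1)
      rw [hT0] at h1
      -- Stopping at `0` means `1/ε ≤ κ n`; with `ε ≤ 1` the target rate is then at least a
      -- constant, and the crude trace bound on the initial error suffices.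
      have h2 : 1 ≤ κ * n := by
        refine le_trans ?_ h1
        rw [CharP.cast_eq_zero, zero_add, one_mul]
        exact one_le_one_div hε hε1
      have h3 := sum_filtered_coeff_sq_le hN x (hc' ω - h₀) (μ := fun _ => 1) hc.le
        (fun _ => zero_le_one) (fun j => by
          rw [mul_one]
          exact (stationaryEigenvalues_le_trace H hN x j).trans (htr.trans (le_max_left _ _)))
      simp only [one_mul] at h3
      rw [← hinit, sum_sq_transpose_mulVec] at h3
      rw [empiricalDistSq, hTop0]
      calc 1 / (N : ℝ) * ∑ i, (f ω 0 (x i).1 - f₀ (x i)) ^ 2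
          ≤ 1 / (N : ℝ) * (N * c * ‖hc' ω - h₀‖ ^ 2) := by gcongr
        _ = c * ‖hc' ω - h₀‖ ^ 2 * 1 := by field_simp
        _ ≤ c * CHmax ^ 2 * (κ * n) := by gcongr
        _ ≤ (3 * ((2 * κ + d / C) * CHmax ^ 2) + 3 * t + d) * n + c * CHmax ^ 2 * (κ * n) :=
          le_add_of_nonneg_left (by positivity)
        _ = _ := by ring
    · have hTop0 := hopt.pos hC hε hT0
      have hη : 0 < Top ω * ε := by positivity
      have hgmax : max (g ω (Tmax ω)) 0 ≤ d * n := by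
        refine max_le (hgT.trans ?_) (by positivity)
        gcongr
        exact le_max_left _ _
      have hTopinv : 1 / (Top ω * ε) ≤ (2 * κ + d / C) * n := by
        have h1 := hopt.div_le hC hε hT0
        have h2 := hTω.one_div_le hσ hpos hε hsum hT0
        have h3 := hκ_le _ hCω.1
        have h4 : C / (Tmax ω * ε) ≤ C * (2 * (κ * n)) := by
          rw [div_eq_mul_one_div]
          gcongr
          linarith
        have h5 : C / (Top ω * ε) ≤ C * (2 * (κ * n)) + d * n := by linarith
        calc 1 / (Top ω * ε) = C / (Top ω * ε) / C := by field_simp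
          _ ≤ (C * (2 * (κ * n)) + d * n) / C := by gcongr
          _ = _ := by field_simp
      have hbias := sum_filtered_coeff_sq_le hN x (hc' ω - h₀)
        (μ := fun j => ((1 - ε * lam j) ^ Top ω) ^ 2) (B := 1 / (Top ω * ε)) (by positivity)
        (fun _ => sq_nonneg _)
        (fun j => mul_shrinkage_sq_le hε (hlam0 j) (hεlam j) hTop0)
      rw [← hinit] at hbias
      have hnoise : ∑ j, (1 - (1 - ε * lam j) ^ Top ω) ^ 2 *
          ((stationaryEigenvectors H x).transpose.mulVec fun i => w i ω) j ^ 2 ≤ N * (t * n) := by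
        refine le_trans (Finset.sum_le_sum fun j _ => ?_) hVω'
        exact mul_le_mul_of_nonneg_right (one_sub_shrinkage_sq_mono hε (hlam0 j) (hεlam j)
          (hopt.1.trans (hTle ω hω))) (sq_nonneg _)
      have hdrift := (hdiff _ hopt.1).trans ((hmono hopt.1).trans ((le_max_left _ 0).trans hgmax))
      have hmain := empiricalDistSq_iterate_le H hN hYω hup (Top ω)
      calc _ ≤ _ := hmain
        _ ≤ 3 / N * (N * ((2 * κ + d / C) * n) * CHmax ^ 2) + 3 / N * (N * (t * n)) + d * n := by
          refine add_le_add (add_le_add ?_ ?_) hdrift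
          · refine mul_le_mul_of_nonneg_left (hbias.trans ?_) (by positivity)
            gcongr
          · exact mul_le_mul_of_nonneg_left hnoise (by positivity)
        _ = (3 * ((2 * κ + d / C) * CHmax ^ 2) + 3 * t + d) * n := by field_simp
        _ ≤ _ := by
          have : 0 ≤ c * CHmax ^ 2 * κ * n := by positivity
          linarith
  -- The good event and its failure bound `exp (-N κ n)` do not involve `ω₀`; almost surely `ϱ² ≤ κ
  -- n`, so the bound holds at almost every value of `ϱ` with both universal constants equal to `1`.
  · filter_upwards [hϱ, hCH] with ω₀ hϱω hCω
    have hϱle := (hϱω.sq_le hN hσ (hmin.trans_le hCω.1) hc hsum).trans (hκ_le _ hCω.1)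
    have hprob : P.real (G₀ ∩ {ω | N * (t * n) < V ω}ᶜ) = 1 - P.real {ω | N * (t * n) < V ω} := by
      rw [← probReal_compl_eq_one_sub hEm]
      refine measureReal_congr ?_
      filter_upwards [hG₀] with ω hω
      exact propext ⟨fun h => h.2, fun h => ⟨hω, h⟩⟩
    rw [hprob, one_mul]
    refine sub_le_sub_left (htail.trans (Real.exp_le_exp.2 ?_)) 1
    have := mul_le_mul_of_nonneg_left hϱle hN'.le
    linarith
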